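/- Let $\alpha>0$, $\lambda>0$ and $H=\tfrac12+\alpha$, and let $\{\zeta_j\}_{j\in\mathbb Z}$ be independent, identically distributed real random variables with mean zero and variance one. For $n\ge 1$ put $$C_j^{\lambda/n}=\begin{cases}\frac{1}{\Gamma(\alpha)}\,j^{\alpha-1}e^{-\frac{\lambda}{n}j}, & j\ge 1,\\ 0,& j\le 0,\end{cases}\qquad Y_k^{\lambda/n}=\sum_{j\in\mathbb Z}C_j^{\lambda/n}\,\zeta_{k-j},$$ $$S_n(t)=\sum_{k=1}^{[t]}Y_k^{\lambda/n}+(t-[t])\,Y_{[t]+1}^{\lambda/n},\qquad t\ge 0,$$ where $[t]$ is the integer part of $t$. Let $B(dy)$ be an independently scattered Gaussian random measure on $\mathbb R$ with control measure $\sigma^2\,dy$, where $\sigma=1/\Gamma(\alpha)$, and let $$Z^1_{H,\lambda}(t)=\int_{\mathbb R}\left(\int_0^t (s-y)_+^{H-\frac32}e^{-\lambda(s-y)_+}\,ds\right)B(dy),\qquad t\ge0,$$ be the tempered Hermite process of order one driven by $B$; here $x_+^{\beta}e^{-\lambda x_+}$ means $x^\beta e^{-\lambda x}$ for $x>0$ and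 $0$ for $x\le 0$. Then the finite-dimensional distributions of $n^{-H}S_n(nt)$ converge to those of $Z^1_{H,\lambda}(t)$: for every $p\ge 1$ and all $t_1,\dots,t_p\ge0$, $$\left(n^{-H}S_n(nt_1),\dots,n^{-H}S_n(nt_p)\right)\longrightarrow\left(Z^1_{H,\lambda}(t_1),\dots,Z^1_{H,\lambda}(t_p)\right)$$ in distribution as $n\to\infty$. -/

import Mathlib

open MeasureTheory ProbabilityTheory Filter Topology

namespace TemperedHermite

noncomputable section

/-- `B` is an independently scattered Gaussian random measure on `ℝ` with control measure `m`:
`B A` is defined (as a random variable) for every Borel set `A` with `m A < ∞`, it is centred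
Gaussian with variance `m A`, values on disjoint sets are independent, and `B` is σ-additive in
the sense of mean square convergence. -/
structure IsGaussianRandomMeasure {Ω : Type*} [MeasurableSpace Ω] (P : Measure Ω)
    (m : Measure ℝ) (B : Set ℝ → Ω → ℝ) : Prop where
  hasLaw : ∀ A, MeasurableSet A → m A < ⊤ → HasLaw (B A) (gaussianReal 0 (m A).toNNReal) P
  indep : ∀ A : ℕ → Set ℝ, (∀ i, MeasurableSet (A i)) → (∀ i, m (A i) < ⊤) →
    Pairwise (fun i j => Disjoint (A i) (A j)) → iIndepFun (fun i => B (A i)) P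
  sigmaAdditive : ∀ A : ℕ → Set ℝ, (∀ i, MeasurableSet (A i)) → m (⋃ i, A i) < ⊤ →
    Pairwise (fun i j => Disjoint (A i) (A j)) →
    Tendsto (fun N : ℕ =>
      eLpNorm (fun ω => B (⋃ i, A i) ω - ∑ i ∈ Finset.range N, B (A i) ω) 2 P) atTop (𝓝 0)

/-- The integral `∑ c, c * B {φ = c}` (over the nonzero values `c`) of a simple function `φ`. -/
def simpleIntegral {Ω : Type*} (B : Set ℝ → Ω → ℝ) (φ : SimpleFunc ℝ ℝ) (ω : Ω) : ℝ :=
  ∑ c ∈ φ.range.filter (fun c => c ≠ 0), c * B (φ ⁻¹' {c}) ω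

/-- `X` is (a version of) the stochastic integral `∫ f(y) B(dy)`: the mean square limit of the
integrals of simple functions that converge to `f` in `L²(m)`. -/
def IsStochasticIntegral {Ω : Type*} [MeasurableSpace Ω] (P : Measure Ω) (m : Measure ℝ)
    (B : Set ℝ → Ω → ℝ) (f : ℝ → ℝ) (X : Ω → ℝ) : Prop :=
  MemLp f 2 m ∧ MemLp X 2 P ∧
  ∃ φ : ℕ → SimpleFunc ℝ ℝ, (∀ k, MemLp (φ k) 2 m) ∧
    Tendsto (fun k => eLpNorm (fun y => f y - φ k y) 2 m) atTop (𝓝 0) ∧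
    Tendsto (fun k => eLpNorm (fun ω => X ω - simpleIntegral B (φ k) ω) 2 P) atTop (𝓝 0)

/-- `x ↦ x₊ ^ β * exp (-lam * x₊)`, which vanishes for `x ≤ 0` (also when `β = 0`). -/
def temperedPower (β lam x : ℝ) : ℝ :=
  if 0 < x then x ^ β * Real.exp (-lam * x) else 0

/-- `g_{H,λ,t}(y) = ∫₀ᵗ (s - y)₊ ^ (H - 3/2) * exp (-λ (s - y)₊) ds`. -/
def kernel (H lam t y : ℝ) : ℝ :=
  ∫ s in (0 : ℝ)..t, temperedPower (H - 3 / 2) lam (s - y)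

/-- `Z` is the tempered Hermite process of order one `Z(t) = ∫ g_{H,λ,t}(y) B(dy)`, `t ≥ 0`, driven
by the Gaussian random measure `B` with control measure `σ² dx`. -/
structure IsTHP {Ω : Type*} [MeasurableSpace Ω] (P : Measure Ω) (σ H lam : ℝ)
    (B : Set ℝ → Ω → ℝ) (Z : ℝ → Ω → ℝ) : Prop where
  randomMeasure : IsGaussianRandomMeasure P (ENNReal.ofReal (σ ^ 2) • volume) B
  integral : ∀ t, 0 ≤ t →
    IsStochasticIntegral P (ENNReal.ofReal (σ ^ 2) • volume) B (kernel H lam t) (Z t)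

/-- `C_j = j ^ (α - 1) * exp (-κ j) / Γ(α)` for `j ≥ 1`, and `C_j = 0` for `j ≤ 0`. -/
def coeff (α κ : ℝ) (j : ℤ) : ℝ :=
  if 1 ≤ j then 1 / Real.Gamma α * (j : ℝ) ^ (α - 1) * Real.exp (-κ * j) else 0

/-- The moving average `Y_k = ∑_{j ∈ ℤ} C_j ζ_{k - j}`. -/
def movingAverage {Ω : Type*} (α κ : ℝ) (ζ : ℤ → Ω → ℝ) (k : ℤ) (ω : Ω) : ℝ :=
  ∑' j : ℤ, coeff α κ j * ζ (k - j) ω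

/-- The linearly interpolated partial sum
`S(t) = ∑_{k=1}^{[t]} Y_k + (t - [t]) Y_{[t]+1}`, for `t ≥ 0`. -/
def partialSum {Ω : Type*} (α κ : ℝ) (ζ : ℤ → Ω → ℝ) (t : ℝ) (ω : Ω) : ℝ :=
  ∑ k ∈ Finset.Icc 1 ⌊t⌋₊, movingAverage α κ ζ (k : ℤ) ω
    + (t - (⌊t⌋₊ : ℝ)) * movingAverage α κ ζ ((⌊t⌋₊ : ℤ) + 1) ω

end

end TemperedHermite

/-! By the Cramér–Wold device, one linear combination of the coordinates at a time is enough. On the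
discrete side it is a series in the innovations with deterministic weights. Linear interpolation
makes the partial sum the integral of a step function, and rescaling time by `n` turns the weight of
`ζ (m + 1)` into `n ^ (-1/2) / Γ(α)` times the kernel discretized at `y = m / n`
(`partialSumWeight_eq_discreteKernel`). The squared weights therefore add up exactly to `Γ(α)⁻²`
times the integral of a squared step function of `y`. By dominated convergence this tends to the
variance of the Gaussian limit (`tendsto_integral_sq_sum_discreteKernel`,
`charFun_sum_stochasticIntegral`).

The discretized kernels are uniformly bounded, so every weight is `O(n ^ (-1/2))` uniformly in its
index. Replacing each factor of the characteristic function by a Gaussian one then costs at most `ε`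
times the squared weight, hence `ε` times a bounded variance in total
(`norm_charFun_weighted_sum_sub_exp_le`).

The delicate point is domination near the diagonal, where the power is singular for `α < 1`. It
rests on `floor_difference_bounds`. -/

namespace TemperedHermite

/-! ### Characteristic functions and normal approximation of weighted sums -/

section CharFun

/-- The characteristic function of a random vector is that of its linear combinations. -/
lemma charFun_map_toLp_eq {Ω : Type*} [MeasurableSpace Ω] {P : Measure Ω} {p : ℕ}
    {X : Ω → Fin p → ℝ} (hX : AEMeasurable X P) (u : EuclideanSpace ℝ (Fin p)) :
    charFun (P.map fun ω => WithLp.toLp 2 (X ω)) u =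
      charFun (P.map fun ω => ∑ r, u r * X ω r) 1 := by
  have h1 : AEMeasurable (fun ω => WithLp.toLp 2 (X ω)) P := by fun_prop
  have h2 : AEMeasurable (fun ω => ∑ r, u r * X ω r) P := by fun_prop
  rw [charFun_apply, charFun_apply_real, integral_map h1 (by fun_prop),
    integral_map h2 (by fun_prop)]
  congr 1 with ω
  simp [PiLp.inner_apply, mul_comm]

/-- **Cramér–Wold device**, in terms of characteristic functions. -/
lemma tendstoInDistribution_pi_of_tendsto_charFun
    {Ω Ω' : Type*} [MeasurableSpace Ω] [MeasurableSpace Ω']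
    {P : Measure Ω} [IsProbabilityMeasure P] {P' : Measure Ω'} [IsProbabilityMeasure P'] {p : ℕ}
    {X : ℕ → Ω → Fin p → ℝ} {Z : Ω' → Fin p → ℝ}
    (hX : ∀ n, AEMeasurable (X n) P) (hZ : AEMeasurable Z P')
    (h : ∀ u : Fin p → ℝ,
      Tendsto (fun n => charFun (P.map fun ω => ∑ r, u r * X n ω r) 1) atTop
        (𝓝 (charFun (P'.map fun ω => ∑ r, u r * Z ω r) 1))) :
    TendstoInDistribution X atTop Z (fun _ => P) P' := by
  -- The characteristic function criterion needs an inner product, hence the passage through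
  -- `EuclideanSpace`.
  have key : TendstoInDistribution (fun n ω => WithLp.toLp 2 (X n ω)) atTop
      (fun ω => WithLp.toLp 2 (Z ω)) (fun _ => P) P' :=
    { forall_aemeasurable := fun n => by have := hX n; fun_prop
      aemeasurable_limit := by fun_prop
      tendsto := by
        refine ProbabilityMeasure.tendsto_iff_tendsto_charFun.2 fun u => ?_
        simp only [ProbabilityMeasure.coe_mk]
        simp_rw [charFun_map_toLp_eq (hX _), charFun_map_toLp_eq hZ]
        exact h u }
  exact key.continuous_comp (g := WithLp.ofLp) (by fun_prop)

/-- Telescoping: factors are exchanged one at a time, and the remaining ones have norm at most one.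
-/
lemma norm_prod_sub_prod_le {ι : Type*} (s : Finset ι) (a b : ι → ℂ)
    (ha : ∀ i, ‖a i‖ ≤ 1) (hb : ∀ i, ‖b i‖ ≤ 1) :
    ‖∏ i ∈ s, a i - ∏ i ∈ s, b i‖ ≤ ∑ i ∈ s, ‖a i - b i‖ := by
  classical
  induction s using Finset.induction_on with
  | empty => simp
  | insert i s hi ih =>
    rw [Finset.prod_insert hi, Finset.prod_insert hi, Finset.sum_insert hi]
    have hP : ‖∏ i ∈ s, a i‖ ≤ 1 := by
      rw [norm_prod]; exact Finset.prod_le_one (fun _ _ => norm_nonneg _) fun i _ => ha i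
    calc ‖a i * ∏ i ∈ s, a i - b i * ∏ i ∈ s, b i‖
        = ‖(a i - b i) * ∏ i ∈ s, a i + b i * (∏ i ∈ s, a i - ∏ i ∈ s, b i)‖ := by ring_nf
      _ ≤ ‖a i - b i‖ * ‖∏ i ∈ s, a i‖ + ‖b i‖ * ‖∏ i ∈ s, a i - ∏ i ∈ s, b i‖ := by
        refine (norm_add_le _ _).trans ?_
        rw [norm_mul, norm_mul]
      _ ≤ ‖a i - b i‖ * 1 + 1 * ∑ i ∈ s, ‖a i - b i‖ := by
        gcongr
        exact hb i
      _ = _ := by ring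

/-- Near the origin the characteristic function of a standardized random variable agrees with the
standard Gaussian one up to `ε x²`. -/
lemma exists_norm_charFun_sub_exp_le {Ω : Type*} [MeasurableSpace Ω] {P : Measure Ω}
    [IsProbabilityMeasure P] {X : Ω → ℝ} (hX : AEMeasurable X P) (h0 : P[X] = 0)
    (h1 : P[X ^ 2] = 1) {ε : ℝ} (hε : 0 < ε) :
    ∃ δ > 0, ∀ x : ℝ, |x| ≤ δ →
      ‖charFun (P.map X) x - Complex.exp (-(x : ℂ) ^ 2 / 2)‖ ≤ ε * x ^ 2 := by
  -- Both characteristic functions share the expansion `1 - x² / 2 + o(x²)`; here it is obtained for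
  -- the Gaussian from the derivative of `exp` at `0`.
  have hexp : (fun x : ℝ => Complex.exp (-(x : ℂ) ^ 2 / 2) - (1 - (x : ℂ) ^ 2 / 2))
      =o[𝓝 0] fun x : ℝ => x ^ 2 := by
    have h := hasDerivAt_iff_isLittleO.1 (Complex.hasDerivAt_exp 0)
    have ht : Tendsto (fun x : ℝ => -(x : ℂ) ^ 2 / 2) (𝓝 0) (𝓝 0) := by
      have : Continuous (fun x : ℝ => -(x : ℂ) ^ 2 / 2) := by fun_prop
      simpa using this.tendsto 0
    have h' := h.comp_tendsto ht
    refine (Asymptotics.IsLittleO.congr_left (f₁ := _) h' ?_).trans_isBigO ?_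
    · intro x
      simp
      ring
    · refine Asymptotics.IsBigO.of_bound 1 (Eventually.of_forall fun x => ?_)
      simp
      nlinarith [sq_nonneg x]
  have h := (taylor_charFun_two hX h0 h1).sub hexp
  have h' := h.bound hε
  rw [Metric.eventually_nhds_iff] at h'
  obtain ⟨δ, hδ, hb⟩ := h'
  refine ⟨δ / 2, by positivity, fun x hx => ?_⟩
  have := hb (y := x) (by simp; linarith)
  simp only [sub_sub_sub_cancel_right] at this
  simpa using this

/-- Pointwise almost sure convergence implies convergence of characteristic functions. -/
lemma tendsto_charFun_of_ae_tendsto {Ω : Type*} [MeasurableSpace Ω] {P : Measure Ω}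
    [IsProbabilityMeasure P] {ι : Type*} {l : Filter ι} [l.IsCountablyGenerated]
    {T : ι → Ω → ℝ} {W : Ω → ℝ}
    (hT : ∀ i, AEMeasurable (T i) P) (hW : AEMeasurable W P)
    (h : ∀ᵐ ω ∂P, Tendsto (fun i => T i ω) l (𝓝 (W ω))) (x : ℝ) :
    Tendsto (fun i => charFun (P.map (T i)) x) l (𝓝 (charFun (P.map W) x)) := by
  have e (T : Ω → ℝ) (hT : AEMeasurable T P) :
      charFun (P.map T) x = ∫ ω, Complex.exp (x * T ω * Complex.I) ∂P := by
    rw [charFun_apply_real, integral_map hT (by fun_prop)]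
  simp_rw [fun i => e (T i) (hT i), e W hW]
  refine tendsto_integral_filter_of_dominated_convergence (fun _ => 1) ?_ ?_ (by simp) ?_
  · refine Eventually.of_forall fun i => ?_
    have := hT i
    exact AEMeasurable.aestronglyMeasurable (by fun_prop)
  · refine Eventually.of_forall fun i => Eventually.of_forall fun ω => ?_
    rw [← Complex.ofReal_mul, Complex.norm_exp_ofReal_mul_I]
  · filter_upwards [h] with ω hω
    have : Continuous fun y : ℝ => Complex.exp (x * y * Complex.I) := by fun_prop
    exact (this.tendsto _).comp hω

/-- Normal approximation for infinite weighted sums of i.i.d. standardized variables. -/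
lemma norm_charFun_weighted_sum_sub_exp_le {Ω : Type*} [MeasurableSpace Ω] {P : Measure Ω}
    [IsProbabilityMeasure P] {ι : Type*} [Countable ι] {ζ : ι → Ω → ℝ} (hindep : iIndepFun ζ P)
    {μ : Measure ℝ} (hμ : ∀ i, HasLaw (ζ i) μ P) {ε δ : ℝ}
    (hδ : ∀ x : ℝ, |x| ≤ δ → ‖charFun μ x - Complex.exp (-(x : ℂ) ^ 2 / 2)‖ ≤ ε * x ^ 2)
    {a : ι → ℝ} (ha : ∀ i, |a i| ≤ δ) (hsum : Summable fun i => a i ^ 2)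
    {W : Ω → ℝ} (hW : AEMeasurable W P) (h : ∀ᵐ ω ∂P, HasSum (fun i => a i * ζ i ω) (W ω)) :
    ‖charFun (P.map W) 1 - Complex.exp (-((∑' i, a i ^ 2 : ℝ) : ℂ) / 2)‖
      ≤ ε * ∑' i, a i ^ 2 := by
  -- An index is needed to see that `μ` is a probability measure.
  rcases isEmpty_or_nonempty ι with hι | ⟨⟨i₀⟩⟩
  · have : W =ᵐ[P] fun _ => 0 := by
      filter_upwards [h] with ω hω
      exact hω.unique (by simp)
    rw [Measure.map_congr this]
    simp
  have : IsProbabilityMeasure μ := (hμ i₀).isProbabilityMeasure_iff.1 inferInstance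
  have hm (i) := (hμ i).aemeasurable
  have hms (s : Finset ι) : AEMeasurable (fun ω => ∑ i ∈ s, a i * ζ i ω) P :=
    Finset.aemeasurable_fun_sum _ fun i _ => (hm i).const_mul _
  have hfin (s : Finset ι) : ‖charFun (P.map fun ω => ∑ i ∈ s, a i * ζ i ω) 1
      - Complex.exp (-((∑ i ∈ s, a i ^ 2 : ℝ) : ℂ) / 2)‖ ≤ ε * ∑ i ∈ s, a i ^ 2 := by
    have hi : iIndepFun (fun i ω => a i * ζ i ω) P :=
      hindep.comp (fun i x => a i * x) (fun i => by fun_prop)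
    rw [(hi.restrict s).charFun_map_fun_finsetSum_eq_prod (fun i _ => (hm i).const_mul _),
      Finset.prod_apply]
    have : Complex.exp (-((∑ i ∈ s, a i ^ 2 : ℝ) : ℂ) / 2)
        = ∏ i ∈ s, Complex.exp (-(a i : ℂ) ^ 2 / 2) := by
      rw [← Complex.exp_sum]
      congr 1
      push_cast
      rw [← Finset.sum_div, Finset.sum_neg_distrib]
    rw [this]
    simp_rw [charFun_map_mul_comp (hm _), mul_one, (hμ _).map_eq]
    refine (norm_prod_sub_prod_le _ _ _ (fun i => norm_charFun_le_one _) fun i => ?_).trans ?_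
    · rw [show -(a i : ℂ) ^ 2 / 2 = ((-(a i) ^ 2 / 2 : ℝ) : ℂ) by push_cast; ring,
        Complex.norm_exp, Complex.ofReal_re, Real.exp_le_one_iff]
      nlinarith [sq_nonneg (a i)]
    · rw [Finset.mul_sum]
      exact Finset.sum_le_sum fun i _ => hδ _ (ha i)
  -- The finite estimate has the same `ε` for every `s`, so it survives the limit along finite
  -- subsets.
  have hlim := tendsto_charFun_of_ae_tendsto hms hW h 1
  have hlim2 : Tendsto (fun s : Finset ι => Complex.exp (-((∑ i ∈ s, a i ^ 2 : ℝ) : ℂ) / 2)) atTop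
      (𝓝 (Complex.exp (-((∑' i, a i ^ 2 : ℝ) : ℂ) / 2))) := by
    have : Continuous fun y : ℝ => Complex.exp (-(y : ℂ) / 2) := by fun_prop
    exact (this.tendsto _).comp hsum.hasSum
  exact le_of_tendsto_of_tendsto (hlim.sub hlim2).norm (hsum.hasSum.const_mul ε)
    (Eventually.of_forall hfin)

end CharFun

/-! ### Gaussian random measures and the law of their stochastic integrals -/

section GaussianIntegral

variable {Ω : Type*} [MeasurableSpace Ω] {P : Measure Ω} {m : Measure ℝ} {B : Set ℝ → Ω → ℝ}

lemma IsGaussianRandomMeasure.empty_ae_eq (hB : IsGaussianRandomMeasure P m B) :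
    B ∅ =ᵐ[P] 0 := by
  have h := hB.hasLaw ∅ .empty (by simp)
  simp only [measure_empty, ENNReal.toNNReal_zero, gaussianReal_zero_var] at h
  have h1 := (ae_dirac_iff (a := (0 : ℝ)) (measurableSet_singleton (0 : ℝ))).2 rfl
  rw [← h.map_eq] at h1
  exact ae_of_ae_map h.aemeasurable h1

lemma IsGaussianRandomMeasure.union_ae_eq (hB : IsGaussianRandomMeasure P m B) {A A' : Set ℝ}
    (hA : MeasurableSet A) (hA' : MeasurableSet A') (hmA : m A < ⊤) (hmA' : m A' < ⊤)
    (hd : Disjoint A A') : B (A ∪ A') =ᵐ[P] fun ω => B A ω + B A' ω := by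
  -- Finite additivity comes from σ-additivity along `A, A', ∅, ∅, …`: the error is constant from `N
  -- = 2` on and tends to zero.
  let S : ℕ → Set ℝ := fun i => if i = 0 then A else if i = 1 then A' else ∅
  have hU : ⋃ i, S i = A ∪ A' := by
    ext x
    simp only [Set.mem_iUnion, Set.mem_union, S]
    constructor
    · rintro ⟨i, hi⟩
      split_ifs at hi <;> simp_all
    · rintro (h | h)
      · exact ⟨0, by simpa⟩
      · exact ⟨1, by simpa⟩
  have hmU : m (A ∪ A') < ⊤ := measure_union_lt_top hmA hmA'
  have h := hB.sigmaAdditive S (fun i => by simp only [S]; split_ifs <;> simp [hA, hA'])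
    (by rwa [hU]) (fun i j hij => by
      simp only [S]
      split_ifs <;> simp_all [hd.symm])
  have h' : ∀ᶠ N in atTop, eLpNorm (fun ω => B (⋃ i, S i) ω - ∑ i ∈ Finset.range N, B (S i) ω) 2 P
      = eLpNorm (fun ω => B (A ∪ A') ω - (B A ω + B A' ω)) 2 P := by
    filter_upwards [eventually_ge_atTop 2] with N hN
    refine eLpNorm_congr_ae ?_
    filter_upwards [hB.empty_ae_eq] with ω hω
    obtain ⟨k, rfl⟩ := Nat.exists_eq_add_of_le' hN
    rw [hU, Finset.sum_range_succ', Finset.sum_range_succ']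
    simp [S, hω]
    ring
  have h0 := tendsto_nhds_unique (h.congr' h') tendsto_const_nhds
  have mA := (hB.hasLaw A hA hmA).aemeasurable
  have mA' := (hB.hasLaw A' hA' hmA').aemeasurable
  have mU := (hB.hasLaw _ (hA.union hA') hmU).aemeasurable
  replace h0 := (eLpNorm_eq_zero_iff (mU.sub (mA.add mA')).aestronglyMeasurable (by simp)).1 h0.symm
  filter_upwards [h0] with ω hω
  simpa [sub_eq_zero] using hω

lemma IsGaussianRandomMeasure.biUnion_ae_eq (hB : IsGaussianRandomMeasure P m B) {ι : Type*}
    (s : Finset ι) {A : ι → Set ℝ} (hA : ∀ i, MeasurableSet (A i)) (hm : ∀ i, m (A i) < ⊤)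
    (hd : Pairwise fun i j => Disjoint (A i) (A j)) :
    B (⋃ i ∈ s, A i) =ᵐ[P] fun ω => ∑ i ∈ s, B (A i) ω := by
  classical
  induction s using Finset.induction_on with
  | empty =>
    simp only [Finset.notMem_empty, Set.iUnion_of_empty, Set.iUnion_empty, Finset.sum_empty]
    exact hB.empty_ae_eq
  | insert i s hi ih =>
    have hU : m (⋃ j ∈ s, A j) < ⊤ := (measure_biUnion_lt_top s.finite_toSet fun j _ => hm j)
    have h := hB.union_ae_eq (hA i) (s.measurableSet_biUnion fun j _ => hA j) (hm i) hU
      (by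
        rw [Set.disjoint_iUnion₂_right]
        intro j hj
        exact hd (by rintro rfl; exact hi hj))
    rw [Finset.set_biUnion_insert]
    filter_upwards [h, ih] with ω h1 h2
    rw [h1, h2, Finset.sum_insert hi]

lemma IsGaussianRandomMeasure.iIndepFun_of_countable (hB : IsGaussianRandomMeasure P m B)
    {ι : Type*} [Countable ι] {A : ι → Set ℝ} (hA : ∀ i, MeasurableSet (A i))
    (hm : ∀ i, m (A i) < ⊤) (hd : Pairwise fun i j => Disjoint (A i) (A j)) :
    iIndepFun (fun i => B (A i)) P := by
  -- The family is carried to `ℕ` by an injection and padded with `∅`, which preserves disjointness.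
  obtain ⟨f, hf⟩ := exists_injective_nat ι
  have hcases (k : ℕ) : (∃ i, f i = k ∧ Function.extend f A (fun _ => ∅) k = A i) ∨
      Function.extend f A (fun _ => ∅) k = ∅ := by
    by_cases hk : ∃ i, f i = k
    · obtain ⟨i, rfl⟩ := hk
      exact Or.inl ⟨i, rfl, hf.extend_apply _ _ _⟩
    · exact Or.inr (Function.extend_apply' _ _ _ hk)
  have h := hB.indep (Function.extend f A fun _ => ∅) (fun k => ?_) (fun k => ?_) ?_
  · have h' := h.precomp hf
    simpa [Function.comp_def, hf.extend_apply] using h'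
  · rcases hcases k with ⟨i, -, hi⟩ | hi <;> rw [hi]
    · exact hA i
    · exact .empty
  · rcases hcases k with ⟨i, -, hi⟩ | hi <;> rw [hi]
    · exact hm i
    · simp
  · intro k l hkl
    rcases hcases k with ⟨i, hik, hi⟩ | hi <;> rcases hcases l with ⟨j, hjl, hj⟩ | hj <;>
      simp only [hi, hj, Set.disjoint_empty, Set.empty_disjoint]
    exact hd (by rintro rfl; exact hkl (hik.symm.trans hjl))

/-- Linear combinations of values on disjoint sets are centred Gaussian. -/
lemma IsGaussianRandomMeasure.charFun_sum (hB : IsGaussianRandomMeasure P m B)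
    {ι : Type*} [Fintype ι] {A : ι → Set ℝ} (hA : ∀ i, MeasurableSet (A i))
    (hm : ∀ i, m (A i) < ⊤) (hd : Pairwise fun i j => Disjoint (A i) (A j)) (a : ι → ℝ) :
    charFun (P.map fun ω => ∑ i, a i * B (A i) ω) 1 =
      Complex.exp (-((∑ i, a i ^ 2 * m.real (A i) : ℝ) : ℂ) / 2) := by
  have hl (i) := hB.hasLaw (A i) (hA i) (hm i)
  have hi : iIndepFun (fun i ω => a i * B (A i) ω) P :=
    (hB.iIndepFun_of_countable hA hm hd).comp (fun i x => a i * x) (fun i => by fun_prop)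
  rw [hi.charFun_map_fun_sum_eq_prod (fun i => (hl i).aemeasurable.const_mul _), Finset.prod_apply]
  simp_rw [charFun_map_mul_comp (hl _).aemeasurable, mul_one, (hl _).map_eq, charFun_gaussianReal]
  rw [← Complex.exp_sum]
  congr 1
  push_cast
  rw [← Finset.sum_neg_distrib, Finset.sum_div]
  refine Finset.sum_congr rfl fun i _ => ?_
  simp [Measure.real, ENNReal.toReal]
  ring

/-- The common level sets of finitely many simple functions, outside their common zero set. -/
abbrev JointLevel {p : ℕ} (φ : Fin p → SimpleFunc ℝ ℝ) : Type :=
  {c : (r : Fin p) → (φ r).range // ∃ r, (c r : ℝ) ≠ 0}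

/-- The set on which `φ r = c r` for every `r`. -/
def JointLevel.set {p : ℕ} {φ : Fin p → SimpleFunc ℝ ℝ} (c : JointLevel φ) : Set ℝ :=
  {y | ∀ r, φ r y = c.1 r}

variable {p : ℕ} {φ : Fin p → SimpleFunc ℝ ℝ}

lemma JointLevel.measurableSet (c : JointLevel φ) : MeasurableSet c.set := by
  have : c.set = ⋂ r, φ r ⁻¹' {(c.1 r : ℝ)} := by ext y; simp [JointLevel.set]
  rw [this]
  exact MeasurableSet.iInter fun r => (φ r).measurableSet_fiber _

lemma JointLevel.measure_lt_top (hφ : ∀ r, MemLp (φ r) 2 m) (c : JointLevel φ) :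
    m c.set < ⊤ := by
  obtain ⟨r, hr⟩ := c.2
  refine (measure_mono ?_).trans_lt
    (SimpleFunc.measure_preimage_lt_top_of_memLp (by simp) (by simp) (φ r) (hφ r) _ hr)
  intro y hy
  exact hy r

lemma JointLevel.pairwise_disjoint :
    Pairwise fun c d : JointLevel φ => Disjoint c.set d.set := by
  intro c d hcd
  rw [Set.disjoint_left]
  intro y hc hd
  refine hcd (Subtype.ext (funext fun r => Subtype.ext ?_))
  rw [← hc r, ← hd r]

lemma preimage_eq_biUnion_jointLevel [DecidableEq ℝ] (r : Fin p) {x : ℝ} (hx : x ≠ 0) :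
    φ r ⁻¹' {x} = ⋃ c ∈ Finset.univ.filter (fun c : JointLevel φ => (c.1 r : ℝ) = x), c.set := by
  ext y
  simp only [Set.mem_preimage, Set.mem_singleton_iff, Finset.mem_filter, Finset.mem_univ, true_and,
    Set.mem_iUnion, exists_prop]
  constructor
  · intro h
    exact ⟨⟨fun r => ⟨φ r y, (φ r).mem_range_self y⟩, ⟨r, by simpa [h] using hx⟩⟩, h, fun r => rfl⟩
  · rintro ⟨c, hc, hy⟩
    rw [hy r, hc]

/-- The level sets of different `φ r` overlap. Refining them to a common partition expresses all the
integrals through the same independent Gaussians, which gives their joint law. -/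
lemma simpleIntegral_ae_eq_sum_jointLevel (hB : IsGaussianRandomMeasure P m B)
    (hφ : ∀ r, MemLp (φ r) 2 m) (r : Fin p) :
    simpleIntegral B (φ r) =ᵐ[P] fun ω => ∑ c : JointLevel φ, (c.1 r : ℝ) * B c.set ω := by
  classical
  have h : ∀ᵐ ω ∂P, ∀ x ∈ (φ r).range.filter (fun c => c ≠ 0), B (φ r ⁻¹' {x}) ω =
      ∑ c : JointLevel φ with (c.1 r : ℝ) = x, B c.set ω := by
    rw [Finset.eventually_all]
    intro x hx
    rw [preimage_eq_biUnion_jointLevel r (Finset.mem_filter.1 hx).2]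
    exact hB.biUnion_ae_eq _ JointLevel.measurableSet (JointLevel.measure_lt_top hφ)
      JointLevel.pairwise_disjoint
  filter_upwards [h] with ω hω
  rw [simpleIntegral]
  calc ∑ x ∈ (φ r).range.filter (fun c => c ≠ 0), x * B (φ r ⁻¹' {x}) ω
      = ∑ x ∈ (φ r).range.filter (fun c => c ≠ 0),
          ∑ c : JointLevel φ with (c.1 r : ℝ) = x, (c.1 r : ℝ) * B c.set ω := by
        refine Finset.sum_congr rfl fun x hx => ?_
        rw [hω x hx, Finset.mul_sum]
        refine Finset.sum_congr rfl fun c hc => ?_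
        rw [(Finset.mem_filter.1 hc).2]
    _ = ∑ x ∈ (φ r).range,
          ∑ c : JointLevel φ with (c.1 r : ℝ) = x, (c.1 r : ℝ) * B c.set ω := by
        -- The value `0` can be restored because its terms have coefficient zero.
        refine Finset.sum_subset (Finset.filter_subset _ _) fun x hx hx' => ?_
        have hx0 : x = 0 := by simpa [hx] using hx'
        refine Finset.sum_eq_zero fun c hc => ?_
        rw [(Finset.mem_filter.1 hc).2, hx0, zero_mul]
    _ = ∑ c : JointLevel φ, (c.1 r : ℝ) * B c.set ω :=
        Finset.sum_fiberwise_of_maps_to (fun c _ => (c.1 r).2) _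

lemma integral_sq_sum_simpleFunc (hφ : ∀ r, MemLp (φ r) 2 m) (u : Fin p → ℝ) :
    ∫ y, (∑ r, u r * φ r y) ^ 2 ∂m =
      ∑ c : JointLevel φ, (∑ r, u r * (c.1 r : ℝ)) ^ 2 * m.real c.set := by
  classical
  have hpt (y : ℝ) : (∑ r, u r * φ r y) ^ 2 =
      ∑ c : JointLevel φ, c.set.indicator (fun _ => (∑ r, u r * (c.1 r : ℝ)) ^ 2) y := by
    by_cases hy : ∃ r, φ r y ≠ 0
    · let c : JointLevel φ := ⟨fun r => ⟨φ r y, (φ r).mem_range_self y⟩, hy⟩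
      have hc : y ∈ c.set := fun r => rfl
      rw [Finset.sum_eq_single c]
      · rw [Set.indicator_of_mem hc]
      · intro d _ hd
        refine Set.indicator_of_notMem (fun hyd => ?_) _
        exact Set.disjoint_left.1 (JointLevel.pairwise_disjoint hd) hyd hc
      · simp
    · push Not at hy
      rw [eq_comm, Finset.sum_eq_zero]
      · simp [hy]
      · intro d _
        refine Set.indicator_of_notMem (fun hyd => ?_) _
        obtain ⟨r, hr⟩ := d.2
        exact hr (by rw [← hyd r, hy r])
  simp_rw [hpt]
  rw [integral_finsetSum]
  · refine Finset.sum_congr rfl fun c _ => ?_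
    rw [integral_indicator c.measurableSet, setIntegral_const, smul_eq_mul, mul_comm]
  · intro c _
    rw [integrable_indicator_iff c.measurableSet]
    exact integrableOn_const (JointLevel.measure_lt_top hφ c).ne

lemma charFun_sum_simpleIntegral (hB : IsGaussianRandomMeasure P m B)
    (hφ : ∀ r, MemLp (φ r) 2 m) (u : Fin p → ℝ) :
    charFun (P.map fun ω => ∑ r, u r * simpleIntegral B (φ r) ω) 1 =
      Complex.exp (-((∫ y, (∑ r, u r * φ r y) ^ 2 ∂m : ℝ) : ℂ) / 2) := by
  have h : (fun ω => ∑ r, u r * simpleIntegral B (φ r) ω) =ᵐ[P]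
      fun ω => ∑ c : JointLevel φ, (∑ r, u r * (c.1 r : ℝ)) * B c.set ω := by
    have := ae_all_iff.2 (simpleIntegral_ae_eq_sum_jointLevel hB hφ)
    filter_upwards [this] with ω hω
    simp_rw [hω, Finset.mul_sum, Finset.sum_mul]
    rw [Finset.sum_comm]
    simp_rw [mul_assoc]
  rw [Measure.map_congr h, hB.charFun_sum JointLevel.measurableSet (JointLevel.measure_lt_top hφ)
    JointLevel.pairwise_disjoint, integral_sq_sum_simpleFunc hφ]

lemma aemeasurable_simpleIntegral (hB : IsGaussianRandomMeasure P m B) {φ : SimpleFunc ℝ ℝ}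
    (hφ : MemLp φ 2 m) : AEMeasurable (simpleIntegral B φ) P := by
  refine Finset.aemeasurable_fun_sum _ fun c hc => AEMeasurable.const_mul ?_ _
  exact (hB.hasLaw _ (φ.measurableSet_fiber _) (SimpleFunc.measure_preimage_lt_top_of_memLp
    (by simp) (by simp) φ hφ _ (Finset.mem_filter.1 hc).2)).aemeasurable

lemma tendsto_integral_sq_of_tendsto_eLpNorm {X : Type*} [MeasurableSpace X] {μ : Measure X}
    {f : X → ℝ} {F : ℕ → X → ℝ} (hf : MemLp f 2 μ) (hF : ∀ k, MemLp (F k) 2 μ)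
    (h : Tendsto (fun k => eLpNorm (F k - f) 2 μ) atTop (𝓝 0)) :
    Tendsto (fun k => ∫ x, F k x ^ 2 ∂μ) atTop (𝓝 (∫ x, f x ^ 2 ∂μ)) := by
  have e {g : X → ℝ} (hg : MemLp g 2 μ) : ∫ x, g x ^ 2 ∂μ = ‖hg.toLp g‖ ^ 2 := by
    rw [← real_inner_self_eq_norm_sq, L2.inner_def]
    refine integral_congr_ae ?_
    filter_upwards [hg.coeFn_toLp] with x hx
    simp [hx, sq]
  simp_rw [e hf, fun k => e (hF k)]
  exact ((Lp.tendsto_Lp_iff_tendsto_eLpNorm'' _ hF _ hf).2 h).norm.pow 2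

lemma tendsto_eLpNorm_sum_smul {X : Type*} [MeasurableSpace X] {μ : Measure X}
    {f : Fin p → X → ℝ} {F : ℕ → Fin p → X → ℝ} (u : Fin p → ℝ)
    (hm : ∀ k r, AEStronglyMeasurable (fun x => f r x - F k r x) μ)
    (h : ∀ r, Tendsto (fun k => eLpNorm (fun x => f r x - F k r x) 2 μ) atTop (𝓝 0)) :
    Tendsto (fun k => eLpNorm ((fun x => ∑ r, u r * F k r x) - fun x => ∑ r, u r * f r x) 2 μ)
      atTop (𝓝 0) := by
  have hlim : Tendsto (fun k => ∑ r, ‖u r‖ₑ * eLpNorm (fun x => f r x - F k r x) 2 μ) atTop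
      (𝓝 0) := by
    have := tendsto_finsetSum (s := Finset.univ) (fun r _ =>
      ENNReal.Tendsto.const_mul (a := ‖u r‖ₑ) (h r) (Or.inr (by simp)))
    simpa using this
  refine tendsto_of_tendsto_of_tendsto_of_le_of_le tendsto_const_nhds hlim (fun _ => zero_le) ?_
  intro k
  have : ((fun x => ∑ r, u r * F k r x) - fun x => ∑ r, u r * f r x) =
      -∑ r, u r • fun x => f r x - F k r x := by
    ext x
    simp [mul_sub, Finset.sum_sub_distrib]
  simp only [this, eLpNorm_neg]
  refine (eLpNorm_sum_le (fun r _ => (hm k r).const_smul (u r)) (by norm_num)).trans ?_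
  exact Finset.sum_le_sum fun r _ => (eLpNorm_const_smul _ _ _ _).le

/-- Stochastic integrals with respect to a Gaussian random measure are jointly centred Gaussian,
with covariances given by the Itô isometry. -/
lemma charFun_sum_stochasticIntegral [IsProbabilityMeasure P] (hB : IsGaussianRandomMeasure P m B)
    {f : Fin p → ℝ → ℝ} {X : Fin p → Ω → ℝ} (hX : ∀ r, IsStochasticIntegral P m B (f r) (X r))
    (u : Fin p → ℝ) :
    charFun (P.map fun ω => ∑ r, u r * X r ω) 1 =
      Complex.exp (-((∫ y, (∑ r, u r * f r y) ^ 2 ∂m : ℝ) : ℂ) / 2) := by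
  choose hf hX2 φ hφ hlim hlimX using hX
  have hI (k r) : AEMeasurable (simpleIntegral B (φ r k)) P :=
    aemeasurable_simpleIntegral hB (hφ r k)
  have h1 := tendsto_eLpNorm_sum_smul (F := fun k r => φ r k) u
    (fun k r => ((hf r).sub (hφ r k)).aestronglyMeasurable) hlim
  have h2 := tendsto_eLpNorm_sum_smul (F := fun k r => simpleIntegral B (φ r k)) u
    (fun k r => (hX2 r).aestronglyMeasurable.sub (hI k r).aestronglyMeasurable) hlimX
  have h3 := tendsto_integral_sq_of_tendsto_eLpNorm
    (memLp_finsetSum _ fun r _ => (hf r).const_mul (u r))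
    (fun k => memLp_finsetSum _ fun r _ => (hφ r k).const_mul (u r)) h1
  have hmk (k) : AEMeasurable (fun ω => ∑ r, u r * simpleIntegral B (φ r k) ω) P :=
    Finset.aemeasurable_fun_sum _ fun r _ => (hI k r).const_mul _
  have hmX : AEMeasurable (fun ω => ∑ r, u r * X r ω) P :=
    Finset.aemeasurable_fun_sum _ fun r _ => (hX2 r).aestronglyMeasurable.aemeasurable.const_mul _
  -- Mean square convergence implies convergence in law, while the Gaussian exponents converge by
  -- `h3`; the two limits must agree.
  have h4 := ((tendstoInMeasure_of_tendsto_eLpNorm (by simp)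
    (fun k => (hmk k).aestronglyMeasurable) hmX.aestronglyMeasurable h2).tendstoInDistribution
      hmk).tendsto
  have h5 := ProbabilityMeasure.tendsto_iff_tendsto_charFun.1 h4 1
  simp only [ProbabilityMeasure.coe_mk] at h5
  simp_rw [fun k => charFun_sum_simpleIntegral hB (fun r => hφ r k) u] at h5
  have hc : Continuous fun y : ℝ => Complex.exp (-(y : ℂ) / 2) := by fun_prop
  exact tendsto_nhds_unique h5 ((hc.tendsto _).comp h3)

end GaussianIntegral

/-! ### The tempered power and an integrable majorant stable under discretization -/

section TemperedPower

lemma temperedPower_nonneg (β lam x : ℝ) : 0 ≤ temperedPower β lam x := by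
  unfold temperedPower
  split_ifs <;> positivity

lemma measurable_temperedPower (β lam : ℝ) : Measurable (temperedPower β lam) := by
  unfold temperedPower
  exact Measurable.ite measurableSet_Ioi (by fun_prop) measurable_const

lemma integrable_temperedPower {β lam : ℝ} (hβ : -1 < β) (hlam : 0 < lam) :
    Integrable (temperedPower β lam) := by
  have h : temperedPower β lam =
      (Set.Ioi 0).indicator fun x : ℝ => x ^ β * Real.exp (-lam * x) := by
    ext x
    simp [temperedPower, Set.indicator_apply]
  rw [h, integrable_indicator_iff measurableSet_Ioi]
  have := integrableOn_rpow_mul_exp_neg_mul_rpow (p := 1) (s := β) (b := lam) hβ one_pos hlam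
  simpa using this

lemma continuousAt_temperedPower (β lam : ℝ) {x : ℝ} (hx : x ≠ 0) :
    ContinuousAt (temperedPower β lam) x := by
  rcases hx.lt_or_gt with h | h
  · refine (continuousAt_const (y := (0 : ℝ))).congr ?_
    filter_upwards [Iio_mem_nhds h] with y hy
    simp [temperedPower, not_lt.2 (le_of_lt (show y < 0 from hy))]
  · have : ContinuousAt (fun x : ℝ => x ^ β * Real.exp (-lam * x)) x :=
      (Real.continuousAt_rpow_const _ _ (Or.inl hx)).mul (by fun_prop)
    refine this.congr ?_
    filter_upwards [Ioi_mem_nhds h] with y hy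
    simp [temperedPower, show 0 < y from hy]

/-- An integrable bound for `temperedPower β lam` on `[x / 2, x + 1]`. -/
noncomputable def temperedBound (β lam x : ℝ) : ℝ :=
  temperedPower β lam (x / 2) + Real.exp (lam / 2) * temperedPower β (lam / 2) (x + 1)

lemma temperedBound_nonneg (β lam x : ℝ) : 0 ≤ temperedBound β lam x :=
  add_nonneg (temperedPower_nonneg _ _ _)
    (mul_nonneg (Real.exp_nonneg _) (temperedPower_nonneg _ _ _))

lemma integrable_temperedBound {β lam : ℝ} (hβ : -1 < β) (hlam : 0 < lam) :
    Integrable (temperedBound β lam) :=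
  ((integrable_temperedPower hβ hlam).comp_div two_ne_zero).add
    (((integrable_temperedPower hβ (half_pos hlam)).comp_add_right 1).const_mul _)

lemma temperedPower_le_temperedBound {β lam x z : ℝ} (hlam : 0 ≤ lam)
    (h : 0 < z → 0 < x ∧ x / 2 ≤ z ∧ z ≤ x + 1) :
    temperedPower β lam z ≤ temperedBound β lam x := by
  by_cases hz : 0 < z
  · obtain ⟨hx, hxz, hzx⟩ := h hz
    have hx2 : 0 < x / 2 := by positivity
    have hx1 : 0 < x + 1 := by positivity
    -- The power is largest at the right endpoint if `β ≥ 0` and at the left one if `β ≤ 0`; the sum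
    -- covers both signs.
    have hpow : z ^ β ≤ (x / 2) ^ β + (x + 1) ^ β := by
      rcases le_total 0 β with hβ | hβ
      · have := Real.rpow_le_rpow hz.le hzx hβ
        have := Real.rpow_nonneg hx2.le β
        linarith
      · have := Real.rpow_le_rpow_of_nonpos hx2 hxz hβ
        have := Real.rpow_nonneg hx1.le β
        linarith
    have hexp : Real.exp (-lam * z) ≤ Real.exp (-lam * (x / 2)) := by
      rw [Real.exp_le_exp]
      nlinarith
    -- Writing the decay at `x / 2` in terms of `x + 1` halves the rate and costs the factor `exp
    -- (lam / 2)`.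
    have hsplit : Real.exp (-lam * (x / 2)) =
        Real.exp (lam / 2) * Real.exp (-(lam / 2) * (x + 1)) := by
      rw [← Real.exp_add]
      congr 1
      ring
    simp only [temperedBound, temperedPower, hz, hx2, hx1, if_true]
    calc z ^ β * Real.exp (-lam * z)
        ≤ ((x / 2) ^ β + (x + 1) ^ β) * Real.exp (-lam * (x / 2)) := by gcongr
      _ = (x / 2) ^ β * Real.exp (-lam * (x / 2)) +
          (x + 1) ^ β * Real.exp (-lam * (x / 2)) := by ring
      _ = _ := by
        rw [hsplit]
        ring
  · simp only [temperedPower, hz, if_false]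
    exact temperedBound_nonneg _ _ _

/-- A positive difference of integer parts is at least `1` and is within `1` of `n * (s - y)`, so
the latter is less than twice the former. Discretized arguments thus come no closer to the
singularity than half the true one. -/
lemma floor_difference_bounds {n : ℕ} (hn : 1 ≤ n) (s y : ℝ)
    (h : 0 < ((⌊n * s⌋ : ℝ) - ⌊n * y⌋) / n) :
    0 < s - y ∧ (s - y) / 2 ≤ ((⌊n * s⌋ : ℝ) - ⌊n * y⌋) / n ∧
      ((⌊n * s⌋ : ℝ) - ⌊n * y⌋) / n ≤ (s - y) + 1 := by
  have hn1 : (1 : ℝ) ≤ n := by exact_mod_cast hn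
  have hn0 : (0 : ℝ) < n := by linarith
  rw [div_pos_iff_of_pos_right hn0] at h
  have h1 : (1 : ℝ) ≤ (⌊n * s⌋ : ℝ) - ⌊n * y⌋ := by
    have : (0 : ℤ) < ⌊n * s⌋ - ⌊n * y⌋ := by exact_mod_cast h
    exact_mod_cast this
  have a1 := Int.floor_le (n * s)
  have a2 := Int.lt_floor_add_one (n * s)
  have b1 := Int.floor_le (n * y)
  have b2 := Int.lt_floor_add_one (n * y)
  refine ⟨?_, ?_, ?_⟩
  · have : 0 < n * (s - y) := by linarith
    exact pos_of_mul_pos_right this hn0.le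
  · rw [le_div_iff₀ hn0]
    nlinarith
  · rw [div_le_iff₀ hn0]
    nlinarith

lemma tendsto_floor_mul_div (s : ℝ) :
    Tendsto (fun n : ℕ => (⌊(n : ℝ) * s⌋ : ℝ) / n) atTop (𝓝 s) := by
  have hlow : Tendsto (fun n : ℕ => s - 1 / (n : ℝ)) atTop (𝓝 s) := by
    simpa using tendsto_const_nhds (x := s).sub tendsto_one_div_atTop_nhds_zero_nat
  refine tendsto_of_tendsto_of_tendsto_of_le_of_le' hlow tendsto_const_nhds ?_ ?_
  · filter_upwards [eventually_gt_atTop 0] with n hn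
    have hn0 : (0 : ℝ) < n := by exact_mod_cast hn
    rw [le_div_iff₀ hn0, sub_mul, one_div, inv_mul_cancel₀ hn0.ne']
    linarith [Int.lt_floor_add_one (n * s)]
  · filter_upwards [eventually_gt_atTop 0] with n hn
    have hn0 : (0 : ℝ) < n := by exact_mod_cast hn
    rw [div_le_iff₀ hn0]
    linarith [Int.floor_le (n * s)]

end TemperedPower

/-! ### Discretized kernels and convergence of their `L²` norms -/

section DiscreteKernel

variable {β lam : ℝ}

/-- The discretization of the kernel `∫₀ᵗ (s - y)₊ ^ β exp (-λ (s - y)₊) ds` at `y = m / n`. -/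
noncomputable def discreteKernel (β lam : ℝ) (n : ℕ) (t : ℝ) (m : ℤ) : ℝ :=
  ∫ s in (0 : ℝ)..t, temperedPower β lam (((⌊n * s⌋ : ℝ) - m) / n)

/-- The bound for the kernel and its discretizations. -/
noncomputable def kernelBound (β lam t y : ℝ) : ℝ :=
  ∫ s in (0 : ℝ)..t, temperedBound β lam (s - y)

lemma intervalIntegrable_temperedBound_sub (hβ : -1 < β) (hlam : 0 < lam) (a b y : ℝ) :
    IntervalIntegrable (fun s => temperedBound β lam (s - y)) volume a b :=
  ((integrable_temperedBound hβ hlam).comp_sub_right y).intervalIntegrable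

lemma kernelBound_le (hβ : -1 < β) (hlam : 0 < lam) {t : ℝ} (ht : 0 ≤ t) (y : ℝ) :
    kernelBound β lam t y ≤ ∫ x, temperedBound β lam x := by
  rw [← integral_sub_right_eq_self (μ := volume) (temperedBound β lam) y, kernelBound,
    intervalIntegral.integral_of_le ht]
  exact setIntegral_le_integral ((integrable_temperedBound hβ hlam).comp_sub_right y)
    (Eventually.of_forall fun _ => temperedBound_nonneg _ _ _)

/-- This is the convolution of the indicator of `(0, t]` with the reflected majorant, both
integrable. -/
lemma integrable_kernelBound (hβ : -1 < β) (hlam : 0 < lam) {t : ℝ} (ht : 0 ≤ t) :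
    Integrable (kernelBound β lam t) := by
  have h1 : Integrable ((Set.Ioc 0 t).indicator fun _ : ℝ => (1 : ℝ)) := by
    rw [integrable_indicator_iff measurableSet_Ioc]
    exact integrableOn_const (by simp)
  have h := h1.integrable_convolution (ContinuousLinearMap.mul ℝ ℝ)
    (integrable_temperedBound hβ hlam).comp_neg
  refine h.congr (Eventually.of_forall fun y => ?_)
  simp only [kernelBound, convolution, ContinuousLinearMap.mul_apply', neg_sub]
  rw [intervalIntegral.integral_of_le ht, ← integral_indicator measurableSet_Ioc]
  congr 1 with s
  by_cases hs : s ∈ Set.Ioc 0 t <;> simp [hs]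

lemma measurable_discreteKernel_integrand (n : ℕ) (m : ℤ) :
    Measurable fun s : ℝ => temperedPower β lam (((⌊n * s⌋ : ℝ) - m) / n) := by
  have := measurable_temperedPower β lam
  have h : Measurable fun s : ℝ => ((⌊n * s⌋ : ℝ) - m) / n := by fun_prop
  exact this.comp h

lemma norm_discreteKernel_floor_le (hβ : -1 < β) (hlam : 0 < lam) {n : ℕ} (hn : 1 ≤ n) {t : ℝ}
    (ht : 0 ≤ t) (y : ℝ) :
    ‖discreteKernel β lam n t ⌊n * y⌋‖ ≤ kernelBound β lam t y := by
  refine intervalIntegral.norm_integral_le_of_norm_le ht (Eventually.of_forall fun s _ => ?_)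
    (intervalIntegrable_temperedBound_sub hβ hlam _ _ _)
  rw [Real.norm_of_nonneg (temperedPower_nonneg _ _ _)]
  exact temperedPower_le_temperedBound hlam.le (floor_difference_bounds hn s y)

/-- Each integer `m` is the integer part of `n * (m / n)`, so the bound at real points applies. -/
lemma norm_discreteKernel_le (hβ : -1 < β) (hlam : 0 < lam) {n : ℕ} (hn : 1 ≤ n) {t : ℝ}
    (ht : 0 ≤ t) (m : ℤ) :
    ‖discreteKernel β lam n t m‖ ≤ ∫ x, temperedBound β lam x := by
  have hn0 : (n : ℝ) ≠ 0 := by positivity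
  have h := norm_discreteKernel_floor_le hβ hlam hn ht (m / n)
  rw [mul_div_cancel₀ _ hn0, Int.floor_intCast] at h
  exact h.trans (kernelBound_le hβ hlam ht _)

lemma tendsto_discreteKernel (hβ : -1 < β) (hlam : 0 < lam) (t y : ℝ) :
    Tendsto (fun n : ℕ => discreteKernel β lam n t ⌊n * y⌋) atTop
      (𝓝 (∫ s in (0 : ℝ)..t, temperedPower β lam (s - y))) := by
  refine intervalIntegral.tendsto_integral_filter_of_dominated_convergence
    (fun s => temperedBound β lam (s - y)) ?_ ?_
    (intervalIntegrable_temperedBound_sub hβ hlam _ _ _) ?_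
  · exact Eventually.of_forall fun n =>
      (measurable_discreteKernel_integrand n _).aestronglyMeasurable
  · filter_upwards [eventually_ge_atTop 1] with n hn
    refine Eventually.of_forall fun s _ => ?_
    rw [Real.norm_of_nonneg (temperedPower_nonneg _ _ _)]
    exact temperedPower_le_temperedBound hlam.le (floor_difference_bounds hn s y)
  · have hne : ∀ᵐ s : ℝ, s ≠ y := by simp [ae_iff]
    filter_upwards [hne] with s hs _
    have hlim := (tendsto_floor_mul_div s).sub (tendsto_floor_mul_div y)
    simp_rw [← sub_div] at hlim
    exact (continuousAt_temperedPower β lam (sub_ne_zero.2 hs)).tendsto.comp hlim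

variable {p : ℕ} {t : Fin p → ℝ}

/-- One factor of the square is bounded uniformly in `y`, the other by an integrable function, which
yields an `L¹` majorant independent of `n`. -/
lemma sq_sum_discreteKernel_le (hβ : -1 < β) (hlam : 0 < lam) (ht : ∀ r, 0 ≤ t r)
    (u : Fin p → ℝ) {n : ℕ} (hn : 1 ≤ n) (y : ℝ) :
    ‖(∑ r, u r * discreteKernel β lam n (t r) ⌊n * y⌋) ^ 2‖ ≤
      (∑ r, |u r| * ∫ x, temperedBound β lam x) * ∑ r, |u r| * kernelBound β lam (t r) y := by
  have h1 : |∑ r, u r * discreteKernel β lam n (t r) ⌊n * y⌋| ≤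
      ∑ r, |u r| * kernelBound β lam (t r) y := by
    refine (Finset.abs_sum_le_sum_abs _ _).trans (Finset.sum_le_sum fun r _ => ?_)
    rw [abs_mul]
    gcongr
    exact norm_discreteKernel_floor_le hβ hlam hn (ht r) y
  have h2 : ∑ r, |u r| * kernelBound β lam (t r) y ≤
      ∑ r, |u r| * ∫ x, temperedBound β lam x := by
    gcongr with r
    exact kernelBound_le hβ hlam (ht r) y
  rw [norm_pow, sq, Real.norm_eq_abs]
  exact mul_le_mul (h1.trans h2) h1 (abs_nonneg _) ((abs_nonneg _).trans (h1.trans h2))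

lemma integrable_sum_kernelBound (hβ : -1 < β) (hlam : 0 < lam) (ht : ∀ r, 0 ≤ t r)
    (u : Fin p → ℝ) (c : ℝ) :
    Integrable fun y => c * ∑ r, |u r| * kernelBound β lam (t r) y :=
  (integrable_finsetSum _ fun r _ =>
    (integrable_kernelBound hβ hlam (ht r)).const_mul _).const_mul _

lemma measurable_sq_sum_discreteKernel (u : Fin p → ℝ) (n : ℕ) :
    Measurable fun y : ℝ => (∑ r, u r * discreteKernel β lam n (t r) ⌊n * y⌋) ^ 2 := by
  have h1 : Measurable fun m : ℤ => (∑ r, u r * discreteKernel β lam n (t r) m) ^ 2 :=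
    measurable_from_top
  have h2 : Measurable fun y : ℝ => ⌊n * y⌋ := by fun_prop
  exact h1.comp h2

lemma integrable_sq_sum_discreteKernel (hβ : -1 < β) (hlam : 0 < lam) (ht : ∀ r, 0 ≤ t r)
    (u : Fin p → ℝ) {n : ℕ} (hn : 1 ≤ n) :
    Integrable fun y : ℝ => (∑ r, u r * discreteKernel β lam n (t r) ⌊n * y⌋) ^ 2 :=
  (integrable_sum_kernelBound hβ hlam ht u _).mono'
    (measurable_sq_sum_discreteKernel u n).aestronglyMeasurable
    (Eventually.of_forall (sq_sum_discreteKernel_le hβ hlam ht u hn))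

lemma tendsto_integral_sq_sum_discreteKernel (hβ : -1 < β) (hlam : 0 < lam) (ht : ∀ r, 0 ≤ t r)
    (u : Fin p → ℝ) :
    Tendsto (fun n : ℕ => ∫ y : ℝ, (∑ r, u r * discreteKernel β lam n (t r) ⌊n * y⌋) ^ 2) atTop
      (𝓝 (∫ y, (∑ r, u r * ∫ s in (0 : ℝ)..t r, temperedPower β lam (s - y)) ^ 2)) := by
  refine tendsto_integral_filter_of_dominated_convergence _
    (Eventually.of_forall fun n => (measurable_sq_sum_discreteKernel u n).aestronglyMeasurable)
    ?_ (integrable_sum_kernelBound hβ hlam ht u (∑ r, |u r| * ∫ x, temperedBound β lam x)) ?_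
  · filter_upwards [eventually_ge_atTop 1] with n hn
    exact Eventually.of_forall (sq_sum_discreteKernel_le hβ hlam ht u hn)
  · refine Eventually.of_forall fun y => ?_
    exact (tendsto_finsetSum _ fun r _ =>
      (tendsto_discreteKernel hβ hlam (t r) y).const_mul (u r)).pow 2

end DiscreteKernel

/-! ### Step functions: sums over the integers as integrals -/

section Floor

lemma hasSum_of_integrable_comp_floor {F : ℤ → ℝ} (hF : Integrable fun y : ℝ => F ⌊y⌋) :
    HasSum F (∫ y : ℝ, F ⌊y⌋) := by
  have h := hasSum_integral_iUnion (μ := volume) (f := fun y : ℝ => F ⌊y⌋)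
    (s := fun m : ℤ => Set.Ico (m : ℝ) (m + 1)) (fun m => measurableSet_Ico)
    (Set.pairwise_disjoint_Ico_intCast ℝ) hF.integrableOn
  rw [iUnion_Ico_intCast, setIntegral_univ] at h
  have e : (fun m : ℤ => ∫ y in Set.Ico (m : ℝ) (m + 1), F ⌊y⌋) = F := by
    ext m
    have hc : Set.EqOn (fun y : ℝ => F ⌊y⌋) (fun _ => F m) (Set.Ico (m : ℝ) (m + 1)) := by
      intro y hy
      simp only [Int.floor_eq_iff.2 hy]
    rw [setIntegral_congr_fun measurableSet_Ico hc]
    simp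
  rwa [e] at h

lemma hasSum_of_integrable_comp_floor_mul {F : ℤ → ℝ} {n : ℕ} (hn : 1 ≤ n)
    (hF : Integrable fun y : ℝ => F ⌊n * y⌋) :
    HasSum (fun m => (n : ℝ)⁻¹ * F m) (∫ y : ℝ, F ⌊n * y⌋) := by
  have hn0 : (n : ℝ) ≠ 0 := by positivity
  rw [Measure.integral_comp_mul_left (fun y : ℝ => F ⌊y⌋), smul_eq_mul,
    abs_of_nonneg (by positivity)]
  refine (hasSum_of_integrable_comp_floor ?_).mul_left _
  exact (integrable_comp_mul_left_iff (fun y : ℝ => F ⌊y⌋) hn0).1 hF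

lemma ae_comp_floor_eq {b : ℝ} (c : ℤ → ℝ) (k : ℕ) (hkb : (k : ℝ) ≤ b) (hb : b ≤ k + 1) :
    ∀ᵐ s : ℝ, s ∈ Set.uIoc (k : ℝ) b → c ⌊s⌋ = c k := by
  -- At `s = b = k + 1` the integer part jumps.
  have hne : ∀ᵐ s : ℝ, s ≠ b := by simp [ae_iff]
  filter_upwards [hne] with s hs hmem
  rw [Set.uIoc_of_le hkb] at hmem
  have hfl : ⌊s⌋ = (k : ℤ) := by
    rw [Int.floor_eq_iff]
    have : s < b := lt_of_le_of_ne hmem.2 hs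
    exact ⟨by simpa using hmem.1.le, by simpa using this.trans_le hb⟩
  rw [hfl]

lemma intervalIntegrable_comp_floor_of_le {b : ℝ} (c : ℤ → ℝ) (k : ℕ) (hkb : (k : ℝ) ≤ b)
    (hb : b ≤ k + 1) : IntervalIntegrable (fun s : ℝ => c ⌊s⌋) volume k b := by
  refine (intervalIntegrable_const (c := c k)).congr_ae ?_
  rw [EventuallyEq, ae_restrict_iff' measurableSet_uIoc]
  filter_upwards [ae_comp_floor_eq c k hkb hb] with s hs hmem
  exact (hs hmem).symm

lemma integral_comp_floor_of_le {b : ℝ} (c : ℤ → ℝ) (k : ℕ) (hkb : (k : ℝ) ≤ b)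
    (hb : b ≤ k + 1) : ∫ s in (k : ℝ)..b, c ⌊s⌋ = (b - k) * c k := by
  rw [intervalIntegral.integral_congr_ae (ae_comp_floor_eq c k hkb hb)]
  simp

/-- The integral of a step function is the interpolated partial sum. -/
lemma integral_comp_floor (c : ℤ → ℝ) {x : ℝ} (hx : 0 ≤ x) :
    ∫ s in (0 : ℝ)..x, c ⌊s⌋ =
      ∑ k ∈ Finset.range ⌊x⌋₊, c k + (x - ⌊x⌋₊) * c ⌊x⌋₊ := by
  have hint (k : ℕ) : IntervalIntegrable (fun s : ℝ => c ⌊s⌋) volume (k : ℕ) (k + 1 : ℕ) :=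
    intervalIntegrable_comp_floor_of_le c k (by simp) (by simp)
  have h1 := intervalIntegral.sum_integral_adjacent_intervals (n := ⌊x⌋₊)
    (a := fun k : ℕ => (k : ℝ)) (fun k _ => hint k)
  have h0 := IntervalIntegrable.trans_iterate (n := ⌊x⌋₊)
    (a := fun k : ℕ => (k : ℝ)) (fun k _ => hint k)
  have hl := Nat.floor_le hx
  have hr := (Nat.lt_floor_add_one x).le
  rw [Nat.cast_zero] at h0 h1
  rw [← intervalIntegral.integral_add_adjacent_intervals h0
    (intervalIntegrable_comp_floor_of_le c _ hl hr), ← h1, integral_comp_floor_of_le c _ hl hr]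
  congr 1
  refine Finset.sum_congr rfl fun k _ => ?_
  rw [integral_comp_floor_of_le c k (by simp) (by simp)]
  simp

end Floor

/-! ### Weights of the innovations and almost sure convergence of the series -/

section MovingAverage

/-- The coefficient of the innovation `ζ i` in the interpolated partial sum. -/
noncomputable def partialSumWeight (α κ x : ℝ) (i : ℤ) : ℝ :=
  ∑ k ∈ Finset.Icc 1 ⌊x⌋₊, coeff α κ ((k : ℤ) - i)
    + (x - (⌊x⌋₊ : ℝ)) * coeff α κ ((⌊x⌋₊ : ℤ) + 1 - i)

lemma coeff_div_eq (α lam : ℝ) {n : ℕ} (hn : 1 ≤ n) (j : ℤ) :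
    coeff α (lam / n) j =
      (n : ℝ) ^ (α - 1) / Real.Gamma α * temperedPower (α - 1) lam (j / n) := by
  have hn0 : (0 : ℝ) < n := by exact_mod_cast hn
  by_cases hj : 1 ≤ j
  · have hj0 : (0 : ℝ) < j := by exact_mod_cast hj
    have hpos : (0 : ℝ) < j / n := by positivity
    have hexp : -(lam / n) * (j : ℝ) = -lam * (j / n) := by ring
    have hne : (n : ℝ) ^ (α - 1) ≠ 0 := (Real.rpow_pos_of_pos hn0 _).ne'
    simp only [coeff, temperedPower, hj, hpos, if_true, hexp, Real.div_rpow hj0.le hn0.le]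
    field_simp
  · have : ¬ (0 : ℝ) < j / n := by
      rw [not_lt]
      have : (j : ℝ) ≤ 0 := by exact_mod_cast (by omega : j ≤ 0)
      exact div_nonpos_of_nonpos_of_nonneg this hn0.le
    simp [coeff, temperedPower, hj, this]

/-- On `[k, k + 1)` the interpolated sum grows at rate `Y_{k+1}`, whence the shift to `m + 1`. The
factor `n` from the change of variables and `n ^ (α - 1)` from the coefficients combine to `n ^ α`.
-/
lemma partialSumWeight_eq_discreteKernel (α lam : ℝ) {n : ℕ} (hn : 1 ≤ n) {t : ℝ} (ht : 0 ≤ t)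
    (m : ℤ) :
    partialSumWeight α (lam / n) (n * t) (m + 1) =
      (n : ℝ) ^ α / Real.Gamma α * discreteKernel (α - 1) lam n t m := by
  have hn0 : (0 : ℝ) < n := by exact_mod_cast hn
  have h1 : partialSumWeight α (lam / n) (n * t) (m + 1) =
      ∫ s in (0 : ℝ)..n * t, coeff α (lam / n) (⌊s⌋ - m) := by
    rw [integral_comp_floor (fun k => coeff α (lam / n) (k - m)) (by positivity), partialSumWeight]
    congr 1
    · rw [Finset.range_eq_Ico, ← Finset.Ico_add_one_right_eq_Icc, ← zero_add 1,
        ← Finset.sum_Ico_add']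
      refine Finset.sum_congr rfl fun k _ => ?_
      congr 1
      push_cast
      ring
    · congr 2
      ring
  have h2 := intervalIntegral.integral_comp_mul_left
    (fun s : ℝ => coeff α (lam / n) (⌊s⌋ - m)) hn0.ne' (a := 0) (b := t)
  rw [mul_zero, smul_eq_mul, eq_inv_mul_iff_mul_eq₀ hn0.ne'] at h2
  rw [h1, ← h2, discreteKernel]
  simp_rw [coeff_div_eq α lam hn]
  rw [intervalIntegral.integral_const_mul, ← mul_assoc, ← mul_div_assoc,
    Real.rpow_sub_one hn0.ne', mul_div_cancel₀ _ hn0.ne']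
  simp

lemma summable_coeff (α : ℝ) {κ : ℝ} (hκ : 0 < κ) : Summable (coeff α κ) := by
  have hsupp : Function.support (coeff α κ) ⊆ Set.range ((↑) : ℕ → ℤ) := by
    intro j hj
    have : 1 ≤ j := by
      by_contra h
      exact hj (by simp [coeff, h])
    exact ⟨j.toNat, by simp; omega⟩
  rw [← Nat.cast_injective.summable_iff (fun j hj => by
    by_contra h
    exact hj (hsupp h))]
  -- For `j ≥ 1` the real power is at most the natural power `⌈α⌉₊`, which the exponential absorbs.
  have h := Real.summable_pow_mul_exp_neg_nat_mul ⌈α⌉₊ hκ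
  refine Summable.of_norm_bounded (h.mul_left (|1 / Real.Gamma α|)) fun j => ?_
  simp only [Function.comp_apply, coeff]
  split_ifs with hj
  · have hj1 : (1 : ℝ) ≤ j := by exact_mod_cast hj
    have hpow : (j : ℝ) ^ (α - 1) ≤ (j : ℝ) ^ ⌈α⌉₊ := by
      rw [← Real.rpow_natCast]
      refine Real.rpow_le_rpow_of_exponent_le hj1 ?_
      linarith [Nat.le_ceil α]
    rw [Real.norm_eq_abs, abs_mul, abs_mul, Real.abs_exp, mul_assoc, Int.cast_natCast,
      abs_of_nonneg (Real.rpow_nonneg (by linarith) _)]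
    gcongr
  · simp only [norm_zero]
    positivity

variable {Ω : Type*} [MeasurableSpace Ω] {P : Measure Ω}

/-- A series of random variables with summable `L¹` norms converges almost surely. -/
lemma ae_summable_mul_of_lintegral_le {ι : Type*} [Countable ι] {X : ι → Ω → ℝ}
    (hX : ∀ i, AEMeasurable (X i) P) {C : ENNReal} (hC : C ≠ ⊤) (hXC : ∀ i, ∫⁻ ω, ‖X i ω‖ₑ ∂P ≤ C)
    {a : ι → ℝ} (ha : Summable a) : ∀ᵐ ω ∂P, Summable fun i => a i * X i ω := by
  have hint : ∫⁻ ω, ∑' i, ‖a i * X i ω‖ₑ ∂P ≠ ⊤ := by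
    rw [lintegral_tsum fun i => ((hX i).const_mul (a i)).enorm]
    have hle : ∑' i, ∫⁻ ω, ‖a i * X i ω‖ₑ ∂P ≤ (∑' i, ‖a i‖ₑ) * C := by
      rw [← ENNReal.tsum_mul_right]
      refine ENNReal.tsum_le_tsum fun i => ?_
      simp_rw [enorm_mul]
      rw [lintegral_const_mul'' _ (hX i).enorm]
      gcongr
      exact hXC i
    refine ne_top_of_le_ne_top (ENNReal.mul_ne_top ?_ hC) hle
    exact ENNReal.tsum_coe_ne_top_iff_summable.2 (NNReal.summable_coe.1 (summable_norm_iff.2 ha))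
  filter_upwards [ae_lt_top' (AEMeasurable.tsum fun i =>
    ((hX i).const_mul (a i)).enorm) hint] with ω hω
  exact Summable.of_nnnorm (ENNReal.tsum_coe_ne_top_iff_summable.1 hω.ne)

variable {ζ : ℤ → Ω → ℝ} {α κ : ℝ}

/-- Tempering makes the coefficients absolutely summable, so uniformly bounded first moments
suffice. The substitution `i = k - j` attaches the weights to the innovations. -/
lemma ae_hasSum_movingAverage (hm : ∀ i, AEMeasurable (ζ i) P) {C : ENNReal} (hC : C ≠ ⊤)
    (hζ : ∀ i, ∫⁻ ω, ‖ζ i ω‖ₑ ∂P ≤ C) (hκ : 0 < κ) :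
    ∀ᵐ ω ∂P, ∀ k : ℤ,
      HasSum (fun i => coeff α κ (k - i) * ζ i ω) (movingAverage α κ ζ k ω) := by
  refine ae_all_iff.2 fun k => ?_
  have h := ae_summable_mul_of_lintegral_le (fun j => hm (k - j)) hC (fun j => hζ (k - j))
    (summable_coeff α hκ)
  filter_upwards [h] with ω hω
  have h' := hω.hasSum
  rw [← (Equiv.subLeft k).hasSum_iff] at h'
  simpa [Function.comp_def, movingAverage] using h'

/-- Each partial sum is a finite combination of the countably many moving averages, so one null set
serves all `x`. -/
lemma ae_hasSum_partialSum (hm : ∀ i, AEMeasurable (ζ i) P) {C : ENNReal} (hC : C ≠ ⊤)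
    (hζ : ∀ i, ∫⁻ ω, ‖ζ i ω‖ₑ ∂P ≤ C) (hκ : 0 < κ) :
    ∀ᵐ ω ∂P, ∀ x : ℝ,
      HasSum (fun i => partialSumWeight α κ x i * ζ i ω) (partialSum α κ ζ x ω) := by
  filter_upwards [ae_hasSum_movingAverage hm hC hζ hκ] with ω hω x
  have h := (hasSum_sum fun (k : ℕ) (_ : k ∈ Finset.Icc 1 ⌊x⌋₊) => hω (k : ℤ)).add
    ((hω ((⌊x⌋₊ : ℤ) + 1)).mul_left (x - (⌊x⌋₊ : ℝ)))
  refine HasSum.congr_fun h fun i => ?_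
  rw [partialSumWeight, add_mul, Finset.sum_mul, mul_assoc]

lemma aemeasurable_partialSum (hm : ∀ i, AEMeasurable (ζ i) P) {C : ENNReal} (hC : C ≠ ⊤)
    (hζ : ∀ i, ∫⁻ ω, ‖ζ i ω‖ₑ ∂P ≤ C) (hκ : 0 < κ) (x : ℝ) :
    AEMeasurable (partialSum α κ ζ x) P := by
  refine aemeasurable_of_tendsto_metrizable_ae (atTop : Filter (Finset ℤ))
    (fun s => Finset.aemeasurable_fun_sum s fun i _ =>
      (hm i).const_mul (partialSumWeight α κ x i)) ?_
  filter_upwards [ae_hasSum_partialSum hm hC hζ hκ] with ω hω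
  exact hω x

end MovingAverage

end TemperedHermite

/-! ### Convergence of finite-dimensional distributions -/

theorem theorem5p2
    {Ω : Type*} [MeasurableSpace Ω] (P : Measure Ω) [IsProbabilityMeasure P]
    {Ω' : Type*} [MeasurableSpace Ω'] (P' : Measure Ω') [IsProbabilityMeasure P']
    (α H lam : ℝ) (hα : 0 < α) (hH : H = 1 / 2 + α) (hlam : 0 < lam)
    -- i.i.d. innovations with mean zero and variance one
    (ζ : ℤ → Ω → ℝ) (hindep : iIndepFun ζ P) (hident : ∀ i j, IdentDistrib (ζ i) (ζ j) P P)
    (hL2 : ∀ j, MemLp (ζ j) 2 P) (hmean : ∀ j, ∫ ω, ζ j ω ∂P = 0)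
    (hvar : ∀ j, variance (ζ j) P = 1)
    -- the tempered Hermite process of order one, with control measure `Γ(α)⁻² dx`
    (B : Set ℝ → Ω' → ℝ) (Z : ℝ → Ω' → ℝ)
    (hZ : TemperedHermite.IsTHP P' (1 / Real.Gamma α) H lam B Z)
    (p : ℕ) (t : Fin p → ℝ) (ht : ∀ r, 0 ≤ t r) :
    TendstoInDistribution
      (fun (n : ℕ) (ω : Ω) (r : Fin p) =>
        (n : ℝ) ^ (-H) * TemperedHermite.partialSum α (lam / n) ζ (n * t r) ω)
      atTop (fun (ω : Ω') (r : Fin p) => Z (t r) ω) (fun _ => P) P' := by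
  have hm (i) : AEMeasurable (ζ i) P := (hL2 i).aestronglyMeasurable.aemeasurable
  obtain ⟨C, hC, hζ⟩ : ∃ C : ENNReal, C ≠ ⊤ ∧ ∀ i, ∫⁻ ω, ‖ζ i ω‖ₑ ∂P ≤ C := by
    refine ⟨∫⁻ ω, ‖ζ 0 ω‖ₑ ∂P, ((hL2 0).integrable (by norm_num)).2.ne, fun i => ?_⟩
    exact ((hident i 0).comp measurable_enorm).lintegral_eq.le
  have hmX (n : ℕ) (r : Fin p) : AEMeasurable (fun ω =>
      (n : ℝ) ^ (-H) * TemperedHermite.partialSum α (lam / n) ζ (n * t r) ω) P := by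
    -- For `n = 0` the rate `lam / n` is `0` and nothing is tempered, but the partial sum at time
    -- `0` vanishes.
    rcases Nat.eq_zero_or_pos n with rfl | hn
    · simp [TemperedHermite.partialSum]
    · exact (TemperedHermite.aemeasurable_partialSum hm hC hζ (by positivity) _).const_mul _
  have hint (r : Fin p) := hZ.integral (t r) (ht r)
  refine TemperedHermite.tendstoInDistribution_pi_of_tendsto_charFun
    (fun n => aemeasurable_pi_lambda _ (hmX n))
    (aemeasurable_pi_lambda _ fun r => (hint r).2.1.aestronglyMeasurable.aemeasurable) fun u => ?_
  rw [TemperedHermite.charFun_sum_stochasticIntegral hZ.randomMeasure hint u]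
  have hβ : -1 < α - 1 := by linarith
  have hΓ : 0 < Real.Gamma α := Real.Gamma_pos_of_pos hα
  let Q : ℕ → ℤ → ℝ := fun n m =>
    ∑ r, u r * TemperedHermite.discreteKernel (α - 1) lam n (t r) m
  let a : ℕ → ℤ → ℝ := fun n i => ∑ r, u r * ((n : ℝ) ^ (-H) *
    TemperedHermite.partialSumWeight α (lam / n) (n * t r) i)
  let M : ℝ := ∑ r, |u r| * ∫ x, TemperedHermite.temperedBound (α - 1) lam x
  have ha (n : ℕ) (hn : 1 ≤ n) (m : ℤ) :
      a n (m + 1) = (n : ℝ) ^ (-(1 / 2) : ℝ) / Real.Gamma α * Q n m := by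
    have hn0 : (0 : ℝ) < n := by exact_mod_cast hn
    have hpow : (n : ℝ) ^ (-(1 / 2) : ℝ) = (n : ℝ) ^ (-H) * (n : ℝ) ^ α := by
      rw [← Real.rpow_add hn0, hH]
      congr 1
      ring
    simp only [a, Q, Finset.mul_sum]
    refine Finset.sum_congr rfl fun r _ => ?_
    rw [TemperedHermite.partialSumWeight_eq_discreteKernel α lam hn (ht r), hpow]
    ring
  have hQ (n : ℕ) (hn : 1 ≤ n) (m : ℤ) : |Q n m| ≤ M := by
    refine (Finset.abs_sum_le_sum_abs _ _).trans (Finset.sum_le_sum fun r _ => ?_)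
    rw [abs_mul]
    gcongr
    exact TemperedHermite.norm_discreteKernel_le hβ hlam hn (ht r) m
  have hasq (n : ℕ) (hn : 1 ≤ n) : HasSum (fun i => a n i ^ 2)
      ((1 / Real.Gamma α) ^ 2 * ∫ y : ℝ, Q n ⌊n * y⌋ ^ 2) := by
    have hn0 : (0 : ℝ) < n := by exact_mod_cast hn
    have h := (TemperedHermite.hasSum_of_integrable_comp_floor_mul (F := fun m => Q n m ^ 2) hn
      (TemperedHermite.integrable_sq_sum_discreteKernel hβ hlam ht u hn)).mul_left
        ((1 / Real.Gamma α) ^ 2)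
    rw [← (Equiv.addRight (1 : ℤ)).hasSum_iff]
    refine HasSum.congr_fun h fun m => ?_
    -- The squared normalization is the mesh `1 / n`, so the sum of squares is exactly an integral.
    have hsq : ((n : ℝ) ^ (-(1 / 2) : ℝ)) ^ 2 = (n : ℝ)⁻¹ := by
      rw [← Real.rpow_natCast, ← Real.rpow_mul hn0.le, ← Real.rpow_neg_one]
      norm_num
    simp only [Function.comp_apply, Equiv.coe_addRight, ha n hn, mul_pow, div_pow, hsq]
    ring
  have hlim : Tendsto (fun n : ℕ => ∑' i, a n i ^ 2) atTop
      (𝓝 (∫ y, (∑ r, u r * TemperedHermite.kernel H lam (t r) y) ^ 2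
        ∂(ENNReal.ofReal ((1 / Real.Gamma α) ^ 2) • volume))) := by
    rw [integral_smul_measure, ENNReal.toReal_ofReal (by positivity), smul_eq_mul]
    have h := (TemperedHermite.tendsto_integral_sq_sum_discreteKernel hβ hlam ht u).const_mul
      ((1 / Real.Gamma α) ^ 2)
    have hβH : H - 3 / 2 = α - 1 := by rw [hH]; ring
    simp only [TemperedHermite.kernel, hβH]
    refine h.congr' ?_
    filter_upwards [eventually_ge_atTop 1] with n hn
    exact (hasq n hn).tsum_eq.symm
  have hsmall : Tendsto (fun n : ℕ => (n : ℝ) ^ (-(1 / 2) : ℝ) / Real.Gamma α * M) atTop (𝓝 0) := by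
    have := (tendsto_rpow_neg_atTop (y := (1 / 2 : ℝ)) (by norm_num)).comp
      tendsto_natCast_atTop_atTop
    simpa using (this.div_const (Real.Gamma α)).mul_const M
  set V : ℝ := ∫ y, (∑ r, u r * TemperedHermite.kernel H lam (t r) y) ^ 2
    ∂(ENNReal.ofReal ((1 / Real.Gamma α) ^ 2) • volume) with hV
  have hexp : Tendsto (fun n : ℕ => Complex.exp (-((∑' i, a n i ^ 2 : ℝ) : ℂ) / 2)) atTop
      (𝓝 (Complex.exp (-(V : ℂ) / 2))) := by
    have : Continuous fun y : ℝ => Complex.exp (-(y : ℂ) / 2) := by fun_prop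
    exact (this.tendsto _).comp hlim
  have hV0 : 0 ≤ V := integral_nonneg fun y => by positivity
  have hdiff : Tendsto (fun n : ℕ => charFun (P.map fun ω => ∑ r, u r * ((n : ℝ) ^ (-H) *
      TemperedHermite.partialSum α (lam / n) ζ (n * t r) ω)) 1 -
        Complex.exp (-((∑' i, a n i ^ 2 : ℝ) : ℂ) / 2)) atTop (𝓝 0) := by
    rw [Metric.tendsto_nhds]
    intro η hη
    -- The sum of squared weights is eventually below `V + 1`, which keeps the total error below
    -- `η`.
    have hε : 0 < η / (V + 1) := by positivity
    obtain ⟨δ, hδ, hb⟩ := TemperedHermite.exists_norm_charFun_sub_exp_le (hm 0) (hmean 0)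
      ((variance_of_integral_eq_zero (hm 0) (hmean 0)).symm.trans (hvar 0)) hε
    filter_upwards [hsmall.eventually_lt_const hδ, hlim.eventually_lt_const (lt_add_one V),
      eventually_ge_atTop 1] with n h1 h2 hn
    have hn0 : (0 : ℝ) < n := by exact_mod_cast hn
    rw [dist_zero_right]
    refine (TemperedHermite.norm_charFun_weighted_sum_sub_exp_le hindep
      (fun i => ⟨hm i, (hident i 0).map_eq⟩) hb (a := a n) (fun i => ?_) (hasq n hn).summable
      (Finset.aemeasurable_fun_sum _ fun r _ => (hmX n r).const_mul _) ?_).trans_lt ?_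
    · obtain ⟨m, rfl⟩ : ∃ m, i = m + 1 := ⟨i - 1, by ring⟩
      rw [ha n hn, abs_mul, abs_of_nonneg (by positivity)]
      refine le_trans ?_ h1.le
      gcongr
      exact hQ n hn m
    · filter_upwards [TemperedHermite.ae_hasSum_partialSum (α := α) hm hC hζ
        (div_pos hlam hn0)] with ω hω
      have h := hasSum_sum fun (r : Fin p) (_ : r ∈ Finset.univ) =>
        ((hω (n * t r)).mul_left ((n : ℝ) ^ (-H))).mul_left (u r)
      refine HasSum.congr_fun h fun i => ?_
      simp only [a, Finset.sum_mul, mul_assoc]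
    · calc η / (V + 1) * ∑' i, a n i ^ 2 < η / (V + 1) * (V + 1) := by gcongr
        _ = η := by field_simp
  simpa using hdiff.add hexp
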